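/- Let $D$ be an integral domain with quotient field $K$. For a domain $R$ let $\mathrm{Pic}(R)$ be the group of invertible fractional ideals of $R$ modulo the principal ones, and, if $R$ has quotient field $K$, let $\mathrm{Int}(R)=\{f\in K[X]\mid f(r)\in R\text{ for all }r\in R\}$. A Jaffard family of $D$ is a set $\Theta$ of overrings of $D$ (rings $T$ with $D\subseteq T\subseteq K$) such that: either $\Theta=\{K\}$ or $K\notin\Theta$; every $T\in\Theta$ is flat over $D$; $I=\bigcap_{T\in\Theta}IT$ for every ideal $I$ of $D$; $TT'=K$ for all distinct $T,T'\in\Theta$; $\Theta$ is compact in the Zariski topology on the set of overrings of $D$ (whose subbasic open sets are the sets $\{T\mid x_1,\ldots,x_n\in T\}$, with $x_1,\ldots,x_n\in K$); and every nonzero $x\in D$ is a nonunit in only finitely many $T\in\Theta$. Put $$\mathrm{Pic}(D,\Theta)=\{[I]\in\mathrm{Pic}(D)\mid [IT]=[T]\text{ in }\mathrm{Pic}(T)\text{ for all }T\in\Theta\}.$$ Let $\Theta$ be a Jaffard family of $D$. Then the extension map $\pi_\Theta\colon[I]\mapsto([I\,\mathrm{Int}(T)])_{T\in\Theta}$ on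 $\mathrm{Pic}(\mathrm{Int}(D))$ takes its values in the direct sum $\bigoplus_{T\in\Theta}\mathrm{Pic}(\mathrm{Int}(T))$, and the sequence $$0\longrightarrow\mathrm{Pic}(D,\Theta)\longrightarrow\mathrm{Pic}(\mathrm{Int}(D))\xrightarrow{\ \pi_\Theta\ }\bigoplus_{T\in\Theta}\mathrm{Pic}(\mathrm{Int}(T))\longrightarrow 0$$ is exact, where the first map is $[I]\mapsto[I\,\mathrm{Int}(D)]$. -/

import Mathlib

open Polynomial DirectSum

noncomputable section

/-- `Int(R)`: the polynomials `f` with coefficients in `K` such that `f(r)` lies in `R` for every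
`r` in `R`. It is used when `K` is the quotient field of the domain `R`. -/
def integerValued (R K : Type*) [CommRing R] [Field K] [Algebra R K] : Subalgebra R K[X] where
  carrier := {f | ∀ r : R, f.eval (algebraMap R K r) ∈ (algebraMap R K).range}
  mul_mem' := fun hf hg r => by
    simpa only [eval_mul] using mul_mem (hf r) (hg r)
  add_mem' := fun hf hg r => by
    simpa only [eval_add] using add_mem (hf r) (hg r)
  algebraMap_mem' := fun a r => ⟨a, by simp [Polynomial.algebraMap_apply]⟩

section Families

variable (D K : Type*) [CommRing D] [Field K] [Algebra D K]

/-- The Zariski topology on the set of overrings of `D`, that is, of the rings between `D` and its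
quotient field `K`: the sets `B(x₁, …, xₙ) = {T | x₁, …, xₙ ∈ T}` are its subbasic open sets. -/
abbrev overringZariski : TopologicalSpace (Subalgebra D K) :=
  TopologicalSpace.generateFrom {U | ∃ s : Finset K, U = {T : Subalgebra D K | ∀ x ∈ s, x ∈ T}}

/-- Pre-Jaffard families of a domain `D` with quotient field `K`. -/
structure IsPreJaffardFamily (Θ : Set (Subalgebra D K)) : Prop where
  /-- Either `K` is the only member of `Θ`, or `K` is not a member of `Θ`. -/
  eq_or_notMem : Θ = {⊤} ∨ ⊤ ∉ Θ
  /-- Every member of `Θ` is flat over `D`. -/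
  flat : ∀ T ∈ Θ, Module.Flat D T
  /-- `Θ` is complete: `I = ⋂ IT` for every ideal `I` of `D`, as `D`-submodules of `K`. -/
  complete : ∀ I : Ideal D, IsLocalization.coeSubmodule K I =
    ⨅ T ∈ Θ, IsLocalization.coeSubmodule K I * Subalgebra.toSubmodule T
  /-- `Θ` is independent: `TT' = K` for distinct members `T`, `T'`. -/
  independent : ∀ T ∈ Θ, ∀ T' ∈ Θ, T ≠ T' →
    Subalgebra.toSubmodule T * Subalgebra.toSubmodule T' = ⊤
  /-- `Θ` is compact in the Zariski topology. -/
  compact : @IsCompact (Subalgebra D K) (overringZariski D K) Θ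

/-- Jaffard families: the locally finite pre-Jaffard families. -/
structure IsJaffardFamily (Θ : Set (Subalgebra D K)) : Prop
    extends IsPreJaffardFamily D K Θ where
  /-- Every nonzero element of `D` is a nonunit in only finitely many members of `Θ`. -/
  locallyFinite : ∀ x : D, x ≠ 0 → {T ∈ Θ | ¬ IsUnit (algebraMap D T x)}.Finite

end Families

section Picard

variable {D K : Type*} [CommRing D] [IsDomain D] [Field K] [Algebra D K] [IsFractionRing D K]

/-- `(D : t)` generates the unit ideal of a flat overring `T` of `D`, for each `t` in `T`. -/
theorem span_conductor_eq_top (T : Subalgebra D K) (hT : Module.Flat D T) (t : T) :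
    Ideal.span (algebraMap D T '' {s : D | ∃ a : D, algebraMap D T a = algebraMap D T s * t})
      = ⊤ := by
  obtain ⟨a, s, hs, hst⟩ := IsFractionRing.div_surjective (A := D) (t : K)
  have hs0 : algebraMap D K s ≠ 0 := IsFractionRing.to_map_ne_zero_of_mem_nonZeroDivisors hs
  have hrel : ∑ i, (![s, -a] : Fin 2 → D) i • (![t, 1] : Fin 2 → T) i = 0 := by
    apply Subtype.ext
    simp [Fin.sum_univ_two, Algebra.smul_def, ← hst, mul_div_cancel₀ _ hs0]
  obtain ⟨k, b, y, h1, h2⟩ := Module.Flat.isTrivialRelation_of_sum_smul_eq_zero hrel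
  rw [Ideal.eq_top_iff_one]
  have h11 := h1 1
  simp only [Matrix.cons_val_one, Matrix.cons_val_fin_one] at h11
  rw [h11]
  refine Submodule.sum_mem _ fun j _ => ?_
  rw [Algebra.smul_def]
  refine Ideal.mul_mem_right _ _ (Ideal.subset_span ⟨b 1 j, ⟨b 0 j, ?_⟩, rfl⟩)
  have h2j := congrArg (algebraMap D K) (h2 j)
  simp only [Fin.sum_univ_two, Matrix.cons_val_zero, Matrix.cons_val_one,
    Matrix.cons_val_fin_one, map_add, map_mul, map_neg, map_zero] at h2j
  apply Subtype.ext
  change algebraMap D K (b 0 j) = algebraMap D K (b 1 j) * (t : K)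
  rw [← hst]
  field_simp
  linear_combination h2j

/-- If `T` is a flat overring of `D`, then `Int(D) ⊆ Int(T)`. -/
theorem integerValued_subset (T : Subalgebra D K) (hT : Module.Flat D T) {f : K[X]}
    (hf : f ∈ integerValued D K) : f ∈ integerValued T K := by
  intro t
  suffices H : ∀ n : ℕ, ∀ f : K[X], f ∈ integerValued D K → f.degree < n →
      f.eval (t : K) ∈ T by
    obtain ⟨n, hn⟩ : ∃ n : ℕ, f.degree < n :=
      ⟨f.natDegree + 1, lt_of_le_of_lt degree_le_natDegree (by exact_mod_cast Nat.lt_succ_self _)⟩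
    exact ⟨⟨_, H n f hf hn⟩, rfl⟩
  intro n
  induction n with
  | zero =>
    intro f _ hdeg
    have : f = 0 := by
      rw [← degree_eq_bot]
      exact Nat.WithBot.lt_zero_iff.mp (by simpa using hdeg)
    simp [this]
  | succ n ih =>
    intro f hf hdeg
    have key : ∀ s : D, (∃ a : D, algebraMap D T a = algebraMap D T s * t) →
        algebraMap D K s ^ n * f.eval (t : K) ∈ T := by
      rintro s ⟨a, ha⟩
      have ha' : algebraMap D K a = algebraMap D K s * (t : K) := congrArg Subtype.val ha
      have hg : C (algebraMap D K s ^ n) * f - f.comp (C (algebraMap D K s) * X)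
          ∈ integerValued D K := by
        intro r
        obtain ⟨u, hu⟩ := hf r
        obtain ⟨v, hv⟩ := hf (s * r)
        refine ⟨s ^ n * u - v, ?_⟩
        simp only [map_sub, map_mul, map_pow, hu, hv, eval_sub, eval_mul, eval_C, eval_comp,
          eval_X, eval_pow]
      have hgd : (C (algebraMap D K s ^ n) * f - f.comp (C (algebraMap D K s) * X)).degree < n := by
        rw [degree_lt_iff_coeff_zero]
        intro m hm
        rw [coeff_sub, coeff_C_mul, comp_C_mul_X_coeff]
        rcases hm.eq_or_lt with rfl | hlt
        · ring
        · have : f.coeff m = 0 := (degree_lt_iff_coeff_zero f (n + 1)).mp hdeg m hlt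
          simp [this]
      have h1 := ih _ hg hgd
      obtain ⟨v, hv⟩ := hf a
      have h2 : (f.comp (C (algebraMap D K s) * X)).eval (t : K) ∈ T := by
        rw [eval_comp, eval_mul, eval_C, eval_X, ← ha', ← hv]
        exact T.algebraMap_mem v
      have h3 := T.add_mem h1 h2
      rw [← eval_add, sub_add_cancel, eval_mul, eval_C] at h3
      exact h3
    have htop := Ideal.span_pow_eq_top _ (span_conductor_eq_top T hT t) n
    let J : Ideal T :=
      { carrier := {x | (x : K) * f.eval (t : K) ∈ T}
        add_mem' := fun {x y} hx hy => by
          change ((x + y : T) : K) * _ ∈ T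
          rw [Subalgebra.coe_add, add_mul]
          exact T.add_mem hx hy
        zero_mem' := by
          change ((0 : T) : K) * _ ∈ T
          simp
        smul_mem' := fun c x hx => by
          change ((c * x : T) : K) * _ ∈ T
          rw [Subalgebra.coe_mul, mul_assoc]
          exact T.mul_mem c.2 hx }
    have hJ : (1 : T) ∈ J := by
      have hle : Ideal.span ((fun x : T => x ^ n) '' (algebraMap D T ''
          {s : D | ∃ a : D, algebraMap D T a = algebraMap D T s * t})) ≤ J := by
        rw [Ideal.span_le]
        rintro _ ⟨_, ⟨s, hs, rfl⟩, rfl⟩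
        exact key s hs
      rw [htop] at hle
      exact hle trivial
    have : ((1 : T) : K) * f.eval (t : K) ∈ T := hJ
    simpa using this

/-- The inclusion of `Int(D)` into `Int(T)`, for a flat overring `T` of `D`. -/
def integerValuedInclusion (T : Subalgebra D K) (hT : Module.Flat D T) :
    integerValued D K →+* integerValued T K where
  toFun f := ⟨f.1, integerValued_subset T hT f.2⟩
  map_one' := rfl
  map_mul' _ _ := rfl
  map_zero' := rfl
  map_add' _ _ := rfl

/-- The extension map `Pic(Int(D)) → Pic(Int(T))`, `[I] ↦ [I Int(T)]`, for a flat overring `T`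
of `D`. The Picard group of a domain, the group of its invertible fractional ideals modulo the
principal ones, is Mathlib's `ClassGroup`. -/
def picIntExtension (T : Subalgebra D K) (hT : Module.Flat D T) :
    ClassGroup (integerValued D K) →* ClassGroup (integerValued T K) :=
  letI : Algebra (integerValued D K) (integerValued T K) :=
    (integerValuedInclusion T hT).toAlgebra
  haveI : FaithfulSMul (integerValued D K) (integerValued T K) :=
    (faithfulSMul_iff_algebraMap_injective _ _).mpr
      fun f g h => Subtype.ext
        (congrArg (fun x : integerValued T K => (x : K[X])) h : (f : K[X]) = g)
  ClassGroup.extendedHom (integerValued D K) (integerValued T K)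

/-- `Pic(D, Θ)`: the classes `[I]` in `Pic(D)` such that `[IT]` is trivial in `Pic(T)` for every
`T` in `Θ`. -/
def relativePic (Θ : Set (Subalgebra D K)) : Subgroup (ClassGroup D) :=
  ⨅ T ∈ Θ, (ClassGroup.extendedHom D T).ker

/-- The extension map `Pic(D, Θ) → Pic(Int(D))`, `[I] ↦ [I Int(D)]`. -/
def relativePicToPicInt (Θ : Set (Subalgebra D K)) :
    relativePic Θ →* ClassGroup (integerValued D K) :=
  (ClassGroup.extendedHom D (integerValued D K)).comp (relativePic Θ).subtype

end Picard

end

/-! The members of Θ act like localizations of `D`. For `T` in Θ and `d ≠ 0`, the `s` in `D`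
divisible by `d` in every other member generate the unit ideal of `T` (`map_complementaryMultiples`:
flatness, independence, local finiteness). If `d` is a denominator of `g ∈ Int(T)`, such an `s`
gives `s g ∈ Int(D)`. Together with completeness, this shows that ideals of `Int(D)` are determined
by their extensions to the `Int(T)` (`ideal_eq_of_map_eq`).

Since `K[X]` is a principal ideal domain, every class has a representative containing a nonzero
constant `d` of `D` (`ClassGroup.exists_represents_unitary`). Its extension to `Int(T)` is trivial
wherever `d` is a unit, so the values lie in the direct sum.

Evaluation at `0` retracts `Int(D)` onto `D`, which gives injectivity on the left. In the middle, a
principal extension of a representative containing `d` has a generator dividing `d`, hence constant.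
Evaluating the representative at `0` then gives an ideal of `D` that induces it. For surjectivity,
an ideal `J` of `Int(T)` containing a constant is contracted to `Int(D)`; the contraction extends to
`J` in `Int(T)` and to the unit ideal at the other members. -/

noncomputable section
-- Ideal classes through integral ideals
section Represents

open scoped nonZeroDivisors

variable {A : Type*} [CommRing A] [IsDomain A]

/-- An integral ideal represents a class in the class group if it is invertible with that class. -/
def Ideal.Represents (I : Ideal A) (c : ClassGroup A) : Prop :=
  ∃ u : (FractionalIdeal A⁰ (FractionRing A))ˣ,
    (u : FractionalIdeal A⁰ (FractionRing A)) = I ∧ ClassGroup.mk (FractionRing A) u = c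

/-- `I` and `J` are the numerators of a fractional ideal and of its inverse, and `a` is the product
of their denominators. Invertibility thus becomes an equation between integral ideals, which ring
homomorphisms preserve. -/
theorem ClassGroup.exists_represents (c : ClassGroup A) :
    ∃ (I J : Ideal A) (a : A), a ≠ 0 ∧ I * J = Ideal.span {a} ∧ I.Represents c := by
  refine ClassGroup.induction (R := A) (FractionRing A) (fun u => ?_) c
  have hden : ∀ v : FractionalIdeal A⁰ (FractionRing A),
      algebraMap A (FractionRing A) v.den ≠ 0 := fun v =>
    IsFractionRing.to_map_ne_zero_of_mem_nonZeroDivisors v.den.2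
  have hu := FractionalIdeal.den_mul_self_eq_num' A⁰ (FractionRing A) (u : FractionalIdeal _ _)
  have hv := FractionalIdeal.den_mul_self_eq_num' A⁰ (FractionRing A)
    ((u⁻¹ : (FractionalIdeal A⁰ (FractionRing A))ˣ) : FractionalIdeal _ _)
  refine ⟨(u : FractionalIdeal A⁰ (FractionRing A)).num,
    ((u⁻¹ : (FractionalIdeal A⁰ (FractionRing A))ˣ) : FractionalIdeal A⁰ (FractionRing A)).num,
    (u : FractionalIdeal A⁰ (FractionRing A)).den *
    ((u⁻¹ : (FractionalIdeal A⁰ (FractionRing A))ˣ) : FractionalIdeal A⁰ (FractionRing A)).den, ?_, ?_,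
    u * toPrincipalIdeal A (FractionRing A) (Units.mk0 _ (hden u)), ?_, ?_⟩
  · exact mul_ne_zero (nonZeroDivisors.coe_ne_zero _) (nonZeroDivisors.coe_ne_zero _)
  rotate_left
  · rw [Units.val_mul, coe_toPrincipalIdeal, Units.val_mk0, mul_comm]
    exact hu
  · exact (ClassGroup.mk_eq_mk.mpr ⟨_, rfl⟩).symm
  · refine FractionalIdeal.coeIdeal_injective (K := FractionRing A) ?_
    beta_reduce
    rw [FractionalIdeal.coeIdeal_mul, ← hu, ← hv, FractionalIdeal.coeIdeal_span_singleton,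
      mul_mul_mul_comm, Units.mul_inv, mul_one, FractionalIdeal.spanSingleton_mul_spanSingleton,
      map_mul]

theorem Ideal.exists_represents {I J : Ideal A} {a : A} (ha : a ≠ 0)
    (h : I * J = Ideal.span {a}) : ∃ c : ClassGroup A, I.Represents c := by
  have ha' : algebraMap A (FractionRing A) a ≠ 0 := by simpa using ha
  have hIJ : (I : FractionalIdeal A⁰ (FractionRing A)) *
      (J * FractionalIdeal.spanSingleton A⁰ (algebraMap A (FractionRing A) a)⁻¹) = 1 := by
    rw [← mul_assoc, ← FractionalIdeal.coeIdeal_mul, h, FractionalIdeal.coeIdeal_span_singleton,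
      FractionalIdeal.spanSingleton_mul_spanSingleton, mul_inv_cancel₀ ha',
      FractionalIdeal.spanSingleton_one]
  exact ⟨_, Units.mkOfMulEqOne _ _ hIJ, rfl, rfl⟩

namespace Ideal.Represents

variable {I J : Ideal A} {c c' : ClassGroup A}

theorem eq_one_iff (h : I.Represents c) : c = 1 ↔ ∃ x : A, x ≠ 0 ∧ I = Ideal.span {x} := by
  obtain ⟨u, hu, rfl⟩ := h
  exact ClassGroup.mk_eq_one_of_coe_ideal hu

theorem eq_iff (h : I.Represents c) (h' : J.Represents c') :
    c = c' ↔ ∃ x y : A, x ≠ 0 ∧ y ≠ 0 ∧ Ideal.span {x} * I = Ideal.span {y} * J := by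
  obtain ⟨u, hu, rfl⟩ := h
  obtain ⟨v, hv, rfl⟩ := h'
  exact ClassGroup.mk_eq_mk_of_coe_ideal hu hv

theorem unique (h : I.Represents c) (h' : I.Represents c') : c = c' :=
  (h.eq_iff h').mpr ⟨1, 1, one_ne_zero, one_ne_zero, rfl⟩

theorem ne_bot (h : I.Represents c) : I ≠ ⊥ := by
  rintro rfl
  obtain ⟨u, hu, -⟩ := h
  simp at hu

theorem fg (h : I.Represents c) : I.FG := by
  obtain ⟨u, hu, -⟩ := h
  exact Ideal.fg_of_isUnit (S := A⁰) (P := FractionRing A)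
    (IsFractionRing.injective A (FractionRing A)) I ⟨u, hu⟩

variable {B : Type*} [CommRing B] [IsDomain B]

theorem map [Algebra A B] [Module.IsTorsionFree A B] (h : I.Represents c) :
    (I.map (algebraMap A B)).Represents (ClassGroup.extendedHom A B c) := by
  obtain ⟨u, hu, rfl⟩ := h
  refine ⟨_, ?_, (ClassGroup.extendedHom_mk A B u).symm⟩
  rw [Units.coe_map, ← FractionalIdeal.extendedHom_coeIdeal_eq_map (K := FractionRing A), ← hu]
  rfl

end Ideal.Represents
end Represents
-- Denominators, and representatives containing constants
section Denominators

variable {D A K : Type*} [CommRing D] [Field K] [Algebra D K]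
  [CommRing A] [Algebra A K]

theorem map_mem_integerValued (g : A[X]) : g.map (algebraMap A K) ∈ integerValued A K :=
  fun r => ⟨g.eval r, by rw [eval_map_apply]⟩

variable [Algebra D A] [IsScalarTower D A K]

theorem Polynomial.map_mem_integerValued_of_tower (g : D[X]) :
    g.map (algebraMap D K) ∈ integerValued A K := by
  rw [IsScalarTower.algebraMap_eq D A K, ← Polynomial.map_map]
  exact map_mem_integerValued _

/-- The embedding of `D` into `Int(A)` by constant polynomials. -/
def integerValuedConst (D A K : Type*) [CommRing D] [CommRing A] [Field K] [Algebra A K]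
    [Algebra D A] : D →+* integerValued A K :=
  (algebraMap A (integerValued A K)).comp (algebraMap D A)

theorem coe_integerValuedConst (d : D) :
    (integerValuedConst D A K d : K[X]) = C (algebraMap D K d) := by
  rw [IsScalarTower.algebraMap_apply D A K]
  rfl

variable [IsFractionRing D K]

theorem integerValuedConst_ne_zero {d : D} (hd : d ≠ 0) : integerValuedConst D A K d ≠ 0 := by
  intro h
  have := congrArg (Subtype.val) h
  rw [coe_integerValuedConst] at this
  simp [hd] at this

variable [IsDomain D]

theorem exists_common_denominator (s : Finset K[X]) :
    ∃ d : D, d ≠ 0 ∧ ∀ f ∈ s, ∃ g : D[X], g.map (algebraMap D K) = C (algebraMap D K d) * f := by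
  classical
  induction s using Finset.induction_on with
  | empty => exact ⟨1, one_ne_zero, by simp⟩
  | insert f s _ ih =>
    obtain ⟨d, hd, hs⟩ := ih
    obtain ⟨b, hb0, hb⟩ := IsLocalization.integerNormalization_spec (nonZeroDivisors D) f
    refine ⟨b * d, mul_ne_zero (nonZeroDivisors.ne_zero hb0) hd, fun q hq => ?_⟩
    rcases Finset.mem_insert.mp hq with rfl | hq
    · refine ⟨C d * IsLocalization.integerNormalization (nonZeroDivisors D) q, ?_⟩
      rw [Polynomial.map_mul, hb, map_C, Algebra.smul_def, Polynomial.algebraMap_apply, map_mul, C_mul]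
      ring
    · obtain ⟨g, hg⟩ := hs q hq
      exact ⟨C b * g, by rw [Polynomial.map_mul, hg, map_C, map_mul, C_mul, mul_assoc]⟩

/-- Rescaling a finitely generated ideal `I` of `Int(A)` by a generator `h` of `I K[X]`. -/
theorem exists_rescaled_ideal {I : Ideal (integerValued A K)} (hI : I.FG) {h : K[X]}
    (hh : ∀ i ∈ I, h ∣ (i : K[X])) :
    ∃ (d : D) (x : integerValued A K) (J : Ideal (integerValued A K)), d ≠ 0 ∧
      (x : K[X]) = C (algebraMap D K d) * h ∧
      Ideal.span {x} * J = Ideal.span {integerValuedConst D A K d * integerValuedConst D A K d} * I := by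
  classical
  obtain ⟨s, rfl⟩ := hI
  have hs : ∀ i ∈ s, h ∣ (i : K[X]) := fun i hi => hh i (Ideal.subset_span hi)
  choose! q hq using hh
  -- One denominator for `h` and for the quotients of the generators by `h`.
  obtain ⟨d, hd, hden⟩ := exists_common_denominator (D := D) (insert h (s.image q))
  obtain ⟨gh, hgh⟩ := hden h (by simp)
  have key : ∀ i ∈ Ideal.span (s : Set (integerValued A K)), ∃ j : integerValued A K,
      h * j = C (algebraMap D K d) * i := by
    intro i hi
    induction hi using Submodule.span_induction with
    | mem i hi =>
      obtain ⟨g, hg⟩ := hden (q i) (by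
        exact Finset.mem_insert_of_mem (Finset.mem_image_of_mem q hi))
      refine ⟨⟨_, Polynomial.map_mem_integerValued_of_tower g⟩, ?_⟩
      change h * g.map (algebraMap D K) = _
      rw [hg, hq i (Ideal.subset_span hi)]
      ring
    | zero => exact ⟨0, by simp⟩
    | add i i' _ _ hi hi' =>
      obtain ⟨j, hj⟩ := hi
      obtain ⟨j', hj'⟩ := hi'
      exact ⟨j + j', by simp [mul_add, hj, hj']⟩
    | smul r i _ hi =>
      obtain ⟨j, hj⟩ := hi
      refine ⟨r * j, ?_⟩
      simp only [smul_eq_mul, MulMemClass.coe_mul]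
      linear_combination (r : K[X]) * hj
  -- Here `x = d h` and `J = (d / h) I`, whence the factor `d * d`.
  refine ⟨d, ⟨_, Polynomial.map_mem_integerValued_of_tower gh⟩,
    { carrier := {j | ∃ i ∈ Ideal.span (s : Set (integerValued A K)),
        h * j = C (algebraMap D K d) * (i : K[X])}
      add_mem' := ?_, zero_mem' := ⟨0, zero_mem _, by simp⟩, smul_mem' := ?_ }, hd, hgh, ?_⟩
  · rintro j j' ⟨i, hi, hj⟩ ⟨i', hi', hj'⟩
    exact ⟨i + i', add_mem hi hi', by simp [mul_add, hj, hj']⟩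
  · rintro r j ⟨i, hi, hj⟩
    refine ⟨r * i, Ideal.mul_mem_left _ _ hi, ?_⟩
    simp only [smul_eq_mul, MulMemClass.coe_mul]
    linear_combination (r : K[X]) * hj
  · ext y
    simp only [Ideal.mem_span_singleton_mul]
    constructor
    · rintro ⟨j, ⟨i, hi, hj⟩, rfl⟩
      refine ⟨i, hi, Subtype.ext ?_⟩
      simp only [MulMemClass.coe_mul, coe_integerValuedConst, hgh]
      linear_combination -(C (algebraMap D K d)) * hj
    · rintro ⟨i, hi, rfl⟩
      obtain ⟨j, hj⟩ := key i hi
      refine ⟨j, ⟨i, hi, hj⟩, Subtype.ext ?_⟩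
      simp only [MulMemClass.coe_mul, coe_integerValuedConst, hgh]
      linear_combination (C (algebraMap D K d)) * hj

variable (D) in
/-- Every class of `Int(A)` is represented by an ideal containing a nonzero constant of `D`. -/
theorem ClassGroup.exists_represents_unitary (c : ClassGroup (integerValued A K)) :
    ∃ (I J : Ideal (integerValued A K)) (d : D), d ≠ 0 ∧
      I * J = Ideal.span {integerValuedConst D A K d} ∧ I.Represents c := by
  obtain ⟨I, J, f, hf, hIJ, hI⟩ := c.exists_represents
  obtain ⟨c', hJ⟩ := Ideal.exists_represents hf (mul_comm I J ▸ hIJ)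
  have hdvd : ∀ (L : Ideal (integerValued A K)) (h : K[X]),
      L.map (integerValued A K).val = Ideal.span {h} → ∀ i ∈ L, h ∣ (i : K[X]) :=
    fun L h hL i hi => Ideal.mem_span_singleton.mp (hL ▸ Ideal.mem_map_of_mem _ hi)
  obtain ⟨h, hh⟩ := IsPrincipalIdealRing.principal (I.map (integerValued A K).val)
  obtain ⟨k, hk⟩ := IsPrincipalIdealRing.principal (J.map (integerValued A K).val)
  have hhk : Associated (h * k) (f : K[X]) := by
    have := congrArg (Ideal.map (integerValued A K).val) hIJ
    rw [Ideal.map_mul, hh, hk, Ideal.map_span, Set.image_singleton, Ideal.submodule_span_eq,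
      Ideal.submodule_span_eq, Ideal.span_singleton_mul_span_singleton,
      Ideal.span_singleton_eq_span_singleton] at this
    exact this
  obtain ⟨u, hu⟩ := hhk
  -- Absorbing `u` into `k` makes `h * (k * u) = f` exact, so `(d / h) I` and `(e / (k u)) J` have
  -- product generated by `d * e`.
  have hk' : ∀ i ∈ J, k * u ∣ (i : K[X]) := fun i hi =>
    (Units.mul_right_dvd).mpr (hdvd J k hk i hi)
  obtain ⟨d, x, I', hd, hx, hI'⟩ := exists_rescaled_ideal (D := D) hI.fg (hdvd I h hh)
  obtain ⟨e, y, J', he, hy, hJ'⟩ := exists_rescaled_ideal (D := D) hJ.fg hk'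
  have hxy : x * y = integerValuedConst D A K (d * e) * f := by
    apply Subtype.ext
    simp only [MulMemClass.coe_mul, coe_integerValuedConst, hx, hy, ← hu, map_mul]
    ring
  have hde := integerValuedConst_ne_zero (D := D) (A := A) (K := K) (mul_ne_zero hd he)
  have hxy0 : x * y ≠ 0 := by
    rw [hxy]
    exact mul_ne_zero hde hf
  have hprod : I' * J' = Ideal.span {integerValuedConst D A K (d * e)} := by
    rw [← Ideal.span_singleton_mul_right_inj hxy0, ← Ideal.span_singleton_mul_span_singleton,
      mul_mul_mul_comm, hI', hJ', mul_mul_mul_comm, hIJ,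
      Ideal.span_singleton_mul_span_singleton, Ideal.span_singleton_mul_span_singleton,
      Ideal.span_singleton_mul_span_singleton, Ideal.span_singleton_mul_span_singleton, hxy]
    congr 1
    rw [Set.singleton_eq_singleton_iff, map_mul]
    ring
  obtain ⟨b, hb⟩ := Ideal.exists_represents hde hprod
  refine ⟨I', J', d * e, mul_ne_zero hd he, hprod, ?_⟩
  have hd' := integerValuedConst_ne_zero (D := D) (A := A) (K := K) hd
  rwa [← (hb.eq_iff hI).mpr ⟨x, _, left_ne_zero_of_mul hxy0, mul_ne_zero hd' hd', hI'⟩]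

end Denominators
-- Jaffard families as substitutes for localizations
section Jaffard

variable {D K : Type*} [CommRing D] [Field K] [Algebra D K]

/-- The ideal of the `s` in `D` that are multiples of `d` in all members of `Θ` other than `T`. -/
def complementaryMultiples (Θ : Set (Subalgebra D K)) (T : Subalgebra D K) (d : D) : Ideal D :=
  ⨅ T' ∈ Θ \ {T}, (Ideal.span {algebraMap D T' d}).comap (algebraMap D T')

theorem exists_of_mem_complementaryMultiples {Θ : Set (Subalgebra D K)} {T T' : Subalgebra D K}
    {d s : D} (hs : s ∈ complementaryMultiples Θ T d) (hT' : T' ∈ Θ) (hne : T' ≠ T) :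
    ∃ t : T', algebraMap D T' s = algebraMap D T' d * t := by
  have h := (Submodule.mem_iInf _).mp ((Submodule.mem_iInf _).mp hs T') ⟨hT', hne⟩
  obtain ⟨t, ht⟩ := Ideal.mem_span_singleton'.mp (Ideal.mem_comap.mp h)
  exact ⟨t, by rw [← ht, mul_comm]⟩

theorem complementaryMultiples_anti {Θ : Set (Subalgebra D K)} {T : Subalgebra D K} {d e : D}
    (h : d ∣ e) : complementaryMultiples Θ T e ≤ complementaryMultiples Θ T d :=
  iInf₂_mono fun _ _ => Ideal.comap_mono (Ideal.span_singleton_le_span_singleton.mpr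
    (map_dvd _ h))

/-- Extension commutes with products, and the product is contained in the intersection. -/
theorem Ideal.map_finset_inf_eq_top {R S ι : Type*} [CommRing R] [CommRing S] (f : R →+* S)
    (s : Finset ι) (I : ι → Ideal R) (h : ∀ i ∈ s, (I i).map f = ⊤) : (s.inf I).map f = ⊤ := by
  refine top_le_iff.mp (le_trans ?_ (Ideal.map_mono Ideal.prod_le_inf))
  classical
  induction s using Finset.induction_on with
  | empty => simp [Ideal.map_top]
  | insert i s hi ih =>
    rw [Finset.prod_insert hi, Ideal.map_mul, h i (Finset.mem_insert_self _ _), Ideal.top_mul]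
    exact ih fun j hj => h j (Finset.mem_insert_of_mem hj)

theorem IsPreJaffardFamily.mem_range_of_forall_mem {Θ : Set (Subalgebra D K)}
    (hΘ : IsPreJaffardFamily D K Θ) {x : K} (hx : ∀ T ∈ Θ, x ∈ T) : x ∈ (algebraMap D K).range := by
  have htop : IsLocalization.coeSubmodule K (⊤ : Ideal D) = 1 := IsLocalization.coeSubmodule_top K
  have h := hΘ.complete ⊤
  simp only [htop, one_mul] at h
  have hx1 : x ∈ (1 : Submodule D K) := by
    rw [h]
    exact (Submodule.mem_iInf _).mpr fun T => (Submodule.mem_iInf _).mpr fun hT => hx T hT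
  exact Submodule.mem_one.mp hx1

theorem IsPreJaffardFamily.mem_integerValued {Θ : Set (Subalgebra D K)}
    (hΘ : IsPreJaffardFamily D K Θ) {f : K[X]} (hf : ∀ T ∈ Θ, f ∈ integerValued T K) :
    f ∈ integerValued D K := by
  intro r
  refine hΘ.mem_range_of_forall_mem fun T hT => ?_
  obtain ⟨t, ht⟩ := hf T hT (algebraMap D T r)
  rw [← IsScalarTower.algebraMap_apply] at ht
  rw [← ht]
  exact t.2

/-- If `g ∈ Int(T)` and `s` is a multiple of a denominator of `g` in the members of `Θ` other than
`T`, then `s g ∈ Int(D)`. -/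
theorem IsPreJaffardFamily.const_mul_mem_integerValued {Θ : Set (Subalgebra D K)}
    (hΘ : IsPreJaffardFamily D K Θ) {T : Subalgebra D K} {g : K[X]}
    (hg : g ∈ integerValued T K) {d : D} {p : D[X]}
    (hp : p.map (algebraMap D K) = C (algebraMap D K d) * g) {s : D}
    (hs : s ∈ complementaryMultiples Θ T d) :
    C (algebraMap D K s) * g ∈ integerValued D K := by
  refine hΘ.mem_integerValued fun T' hT' => ?_
  by_cases hne : T' = T
  · subst hne
    exact mul_mem (coe_integerValuedConst (A := T') (K := K) s ▸ Subtype.prop _) hg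
  · obtain ⟨t, ht⟩ := exists_of_mem_complementaryMultiples hs hT' hne
    have ht' : algebraMap D K s = algebraMap D K d * (t : K) := congrArg Subtype.val ht
    rw [ht', C_mul, mul_right_comm, ← hp]
    exact mul_mem (Polynomial.map_mem_integerValued_of_tower p)
      ((integerValued T' K).algebraMap_mem t)

/-- An ideal of `D` that extends to the unit ideal in all members of `Θ` is the unit ideal. -/
theorem IsPreJaffardFamily.eq_top_of_map_eq_top [IsFractionRing D K] {Θ : Set (Subalgebra D K)}
    (hΘ : IsPreJaffardFamily D K Θ) {I : Ideal D}
    (h : ∀ T ∈ Θ, I.map (algebraMap D T) = ⊤) :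
    I = ⊤ := by
  have h1 : (1 : K) ∈ IsLocalization.coeSubmodule K I := by
    rw [hΘ.complete I]
    refine (Submodule.mem_iInf _).mpr fun T => (Submodule.mem_iInf _).mpr fun hT => ?_
    have key : ∀ t ∈ I.map (algebraMap D T), (t : K) ∈
        IsLocalization.coeSubmodule K I * Subalgebra.toSubmodule T := by
      intro t ht
      induction ht using Submodule.span_induction with
      | mem t ht =>
        obtain ⟨a, ha, rfl⟩ := ht
        have := Submodule.mul_mem_mul ((IsLocalization.mem_coeSubmodule K I).mpr ⟨a, ha, rfl⟩)
          (show (1 : K) ∈ Subalgebra.toSubmodule T from T.one_mem)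
        rwa [mul_one] at this
      | zero => exact zero_mem _
      | add t u _ _ ht hu => exact add_mem ht hu
      | smul r t _ ht =>
        have := Submodule.mul_mem_mul ht (show (r : K) ∈ Subalgebra.toSubmodule T from r.2)
        rw [mul_assoc] at this
        change (r : K) * t ∈ _
        rw [mul_comm (r : K)]
        have hTT : Subalgebra.toSubmodule T * Subalgebra.toSubmodule T =
          Subalgebra.toSubmodule T := T.isIdempotentElem_toSubmodule
        rwa [hTT] at this
    exact key 1 (by rw [h T hT]; trivial)
  obtain ⟨a, ha, ha'⟩ := (IsLocalization.mem_coeSubmodule K I).mp h1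
  have : a = 1 := IsFractionRing.injective D K (by rw [ha', map_one])
  rwa [Ideal.eq_top_iff_one, ← this]

variable [IsDomain D] [IsFractionRing D K]

/-- The ideal of the `s` in `D` such that `s x` lies in `T`. -/
def Subalgebra.denominators (T : Subalgebra D K) (x : K) : Ideal D where
  carrier := {s | algebraMap D K s * x ∈ T}
  add_mem' := fun {s t} hs ht => by
    change algebraMap D K (s + t) * x ∈ T
    rw [map_add, add_mul]
    exact T.add_mem hs ht
  zero_mem' := by simp
  smul_mem' := fun r s hs => by
    change algebraMap D K (r * s) * x ∈ T
    rw [map_mul, mul_assoc]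
    exact T.mul_mem (T.algebraMap_mem r) hs

/-- For `x = t u`, whatever multiplies `t` into `D` multiplies `x` into `T'`, and by flatness these
elements generate the unit ideal of `T`. For a sum, the product of the two denominator ideals
serves. -/
theorem Subalgebra.map_denominators_eq_top {T T' : Subalgebra D K} (hT : Module.Flat D T) {x : K}
    (hx : x ∈ Subalgebra.toSubmodule T * Subalgebra.toSubmodule T') :
    (T'.denominators x).map (algebraMap D T) = ⊤ := by
  induction hx using Submodule.mul_induction_on' with
  | mem_mul_mem t ht u hu =>
    rw [← top_le_iff, ← span_conductor_eq_top T hT ⟨t, ht⟩]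
    refine Ideal.span_mono (Set.image_mono ?_)
    rintro s ⟨a, ha⟩
    have ha' : algebraMap D K a = algebraMap D K s * t := congrArg Subtype.val ha
    change algebraMap D K s * (t * u) ∈ T'
    rw [← mul_assoc, ← ha']
    exact T'.mul_mem (T'.algebraMap_mem a) hu
  | add x _ y _ hx hy =>
    have hle : T'.denominators x * T'.denominators y ≤ T'.denominators (x + y) := by
      refine Ideal.mul_le_inf.trans fun s hs => ?_
      change algebraMap D K s * (x + y) ∈ T'
      rw [mul_add]
      exact T'.add_mem hs.1 hs.2
    rw [← top_le_iff]
    refine le_trans ?_ (Ideal.map_mono hle)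
    rw [Ideal.map_mul, hx, hy, Ideal.top_mul]

namespace IsJaffardFamily

variable {Θ : Set (Subalgebra D K)} (hΘ : IsJaffardFamily D K Θ)
include hΘ

/-- Members where `d` is a unit impose no condition, so finitely many `T'` remain. Divisibility by
`d` in `T'` means that `s` is a denominator of `1 / d` with respect to `T'`, and independence puts
`1 / d` in `T T' = K`. -/
theorem map_complementaryMultiples {T : Subalgebra D K} (hT : T ∈ Θ) {d : D} (hd : d ≠ 0) :
    (complementaryMultiples Θ T d).map (algebraMap D T) = ⊤ := by
  classical
  have hd' : algebraMap D K d ≠ 0 := by simpa using hd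
  let F := (hΘ.locallyFinite d hd).toFinset
  refine top_le_iff.mp (le_trans (top_le_iff.mpr (Ideal.map_finset_inf_eq_top (algebraMap D T)
    (F.erase T) (fun T' => T'.denominators (algebraMap D K d)⁻¹) fun T' hT' => ?_))
    (Ideal.map_mono ?_))
  · have hT'' : T' ∈ Θ := ((hΘ.locallyFinite d hd).mem_toFinset.mp (Finset.mem_of_mem_erase hT')).1
    refine Subalgebra.map_denominators_eq_top (hΘ.flat T hT) ?_
    rw [hΘ.independent T hT T' hT'' (Finset.ne_of_mem_erase hT').symm]
    trivial
  · refine le_iInf₂ fun T' hT' s hs => ?_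
    rw [Ideal.mem_comap]
    by_cases hu : IsUnit (algebraMap D T' d)
    · rw [Ideal.span_singleton_eq_top.mpr hu]
      trivial
    · have hmem : T' ∈ F.erase T := Finset.mem_erase.mpr
        ⟨hT'.2, (hΘ.locallyFinite d hd).mem_toFinset.mpr ⟨hT'.1, hu⟩⟩
      have hs' : algebraMap D K s * (algebraMap D K d)⁻¹ ∈ T' :=
        (Finset.inf_le (f := fun T' : Subalgebra D K => T'.denominators (algebraMap D K d)⁻¹)
          hmem) hs
      refine Ideal.mem_span_singleton'.mpr ⟨⟨_, hs'⟩, Subtype.ext ?_⟩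
      change algebraMap D K s * (algebraMap D K d)⁻¹ * algebraMap D K d = algebraMap D K s
      field_simp

end IsJaffardFamily
end Jaffard
-- Evaluation at zero
section Evaluation

variable {D A K : Type*} [CommRing D] [CommRing A] [Field K] [Algebra A K] [FaithfulSMul A K]
  [Algebra D A]

variable (A K) in
/-- Evaluation at `0`, a retraction of `Int(A)` onto `A`. -/
def integerValuedEvalZero : integerValued A K →+* A where
  toFun f := (f.2 0).choose
  map_one' := FaithfulSMul.algebraMap_injective A K (by
    rw [((1 : integerValued A K).2 0).choose_spec]; simp)
  map_mul' f g := FaithfulSMul.algebraMap_injective A K (by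
    rw [((f * g).2 0).choose_spec, map_mul, (f.2 0).choose_spec, (g.2 0).choose_spec]; simp)
  map_zero' := FaithfulSMul.algebraMap_injective A K (by
    rw [((0 : integerValued A K).2 0).choose_spec]; simp)
  map_add' f g := FaithfulSMul.algebraMap_injective A K (by
    rw [((f + g).2 0).choose_spec, map_add, (f.2 0).choose_spec, (g.2 0).choose_spec]; simp)

theorem algebraMap_integerValuedEvalZero (f : integerValued A K) :
    algebraMap A K (integerValuedEvalZero A K f) = (f : K[X]).eval 0 :=
  (f.2 0).choose_spec.trans (by rw [map_zero])

theorem integerValuedEvalZero_algebraMap (a : A) :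
    integerValuedEvalZero A K (algebraMap A (integerValued A K) a) = a := by
  apply FaithfulSMul.algebraMap_injective A K
  rw [algebraMap_integerValuedEvalZero]
  exact eval_C

/-- A divisor of a nonzero constant in `Int(T)` is constant. -/
theorem eq_algebraMap_of_dvd_const {D K : Type*} [CommRing D] [Field K] [Algebra D K]
    [FaithfulSMul D K] {T : Subalgebra D K} {f : integerValued T K} {d : D}
    (hd : d ≠ 0) (hf : f ∣ integerValuedConst D T K d) :
    f = algebraMap T (integerValued T K) (integerValuedEvalZero T K f) := by
  obtain ⟨g, hg⟩ := hf
  have hdvd : (f : K[X]) ∣ C (algebraMap D K d) :=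
    ⟨g, by rw [← coe_integerValuedConst (A := T), hg]; rfl⟩
  have hdeg : (f : K[X]).natDegree = 0 := by
    have := natDegree_le_of_dvd hdvd (by simpa using hd)
    simpa using this
  obtain ⟨k, hk⟩ := natDegree_eq_zero.mp hdeg
  apply Subtype.ext
  change (f : K[X]) = C (algebraMap T K (integerValuedEvalZero T K f))
  rw [algebraMap_integerValuedEvalZero, ← hk, eval_C]

end Evaluation

/-! ### Local-global principle, injectivity, and the kernel of the extension map -/

section Extension

variable {D K : Type*} [CommRing D] [IsDomain D] [Field K] [Algebra D K] [IsFractionRing D K]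

theorem Ideal.Represents.picIntExtension {T : Subalgebra D K} (hT : Module.Flat D T)
    {I : Ideal (integerValued D K)} {c : ClassGroup (integerValued D K)} (h : I.Represents c) :
    (I.map (integerValuedInclusion T hT)).Represents (picIntExtension T hT c) := by
  let : Algebra (integerValued D K) (integerValued T K) :=
    (integerValuedInclusion T hT).toAlgebra
  have : FaithfulSMul (integerValued D K) (integerValued T K) :=
    (faithfulSMul_iff_algebraMap_injective _ _).mpr
      fun f g h => Subtype.ext
        (congrArg (fun x : integerValued T K => (x : K[X])) h : (f : K[X]) = g)
  exact h.map

theorem integerValuedInclusion_comp_const (T : Subalgebra D K) (hT : Module.Flat D T) :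
    (integerValuedInclusion T hT).comp (integerValuedConst D D K) =
      integerValuedConst D T K := by
  ext d : 2
  rw [coe_integerValuedConst]
  exact coe_integerValuedConst (A := D) d

theorem integerValuedEvalZero_comp_inclusion (T : Subalgebra D K) (hT : Module.Flat D T) :
    (integerValuedEvalZero T K).comp (integerValuedInclusion T hT) =
      (algebraMap D T).comp (integerValuedEvalZero D K) := by
  ext f
  exact (algebraMap_integerValuedEvalZero (A := T) _).trans
    (algebraMap_integerValuedEvalZero f).symm

theorem map_inclusion_eq_top {T : Subalgebra D K} (hT : Module.Flat D T)
    {I J : Ideal (integerValued D K)} {d : D} (hIJ : I * J = Ideal.span {integerValuedConst D D K d})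
    (hd : IsUnit (algebraMap D T d)) : I.map (integerValuedInclusion T hT) = ⊤ := by
  have h : (I * J).map (integerValuedInclusion T hT) = ⊤ := by
    rw [hIJ, Ideal.map_span, Set.image_singleton, Ideal.span_singleton_eq_top,
      ← RingHom.comp_apply, integerValuedInclusion_comp_const]
    exact hd.map (algebraMap T (integerValued T K))
  exact top_le_iff.mp (h ▸ Ideal.map_mono Ideal.mul_le_left)

namespace IsJaffardFamily

variable {Θ : Set (Subalgebra D K)} (hΘ : IsJaffardFamily D K Θ)
include hΘ

/-- Write `y` as a finite combination of elements of `J` over `Int(T)`; `d` is a product of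
denominators of the coefficients, and `s` brings each coefficient into `Int(D)`. -/
theorem exists_mul_mem_of_mem_map {T : Subalgebra D K} (hT : T ∈ Θ)
    {J : Ideal (integerValued D K)} {y : integerValued T K}
    (hy : y ∈ J.map (integerValuedInclusion T (hΘ.flat T hT))) :
    ∃ d : D, d ≠ 0 ∧ ∀ s ∈ complementaryMultiples Θ T d,
      ∃ j ∈ J, (j : K[X]) = C (algebraMap D K s) * (y : K[X]) := by
  induction hy using Submodule.closure_induction with
  | zero => exact ⟨1, one_ne_zero, fun s _ => ⟨0, zero_mem _, by simp⟩⟩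
  | add y z _ _ hy hz =>
    obtain ⟨d, hd, hy⟩ := hy
    obtain ⟨e, he, hz⟩ := hz
    refine ⟨d * e, mul_ne_zero hd he, fun s hs => ?_⟩
    obtain ⟨j, hj, hjy⟩ := hy s (complementaryMultiples_anti (dvd_mul_right d e) hs)
    obtain ⟨k, hk, hkz⟩ := hz s (complementaryMultiples_anti (dvd_mul_left e d) hs)
    exact ⟨j + k, add_mem hj hk, by simp [hjy, hkz, mul_add]⟩
  | smul_mem r y hy =>
    obtain ⟨j, hj, rfl⟩ := hy
    obtain ⟨d, hd, hden⟩ := exists_common_denominator (D := D) {(r : K[X])}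
    obtain ⟨p, hp⟩ := hden r (Finset.mem_singleton_self _)
    refine ⟨d, hd, fun s hs => ⟨⟨_, hΘ.const_mul_mem_integerValued r.2 hp hs⟩ * j,
      Ideal.mul_mem_left _ _ hj, ?_⟩⟩
    exact mul_assoc _ _ _

/-- The `t` in `T` with `t y ∈ L` form an ideal containing generators of the unit ideal of `T`. -/
theorem mem_of_forall_complementaryMultiples {T : Subalgebra D K} (hT : T ∈ Θ)
    {L : Ideal (integerValued T K)} {y : integerValued T K} {d : D} (hd : d ≠ 0)
    (h : ∀ s ∈ complementaryMultiples Θ T d, integerValuedConst D T K s * y ∈ L) : y ∈ L := by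
  let I : Ideal T := Ideal.comap (algebraMap T (integerValued T K))
    (Submodule.comap (LinearMap.toSpanSingleton (integerValued T K) (integerValued T K) y) L)
  have hI : (complementaryMultiples Θ T d).map (algebraMap D T) ≤ I :=
    Ideal.map_le_iff_le_comap.mpr h
  rw [hΘ.map_complementaryMultiples hT hd] at hI
  have h1 : algebraMap T (integerValued T K) 1 * y ∈ L := hI (show (1 : T) ∈ ⊤ from trivial)
  rwa [map_one, one_mul] at h1

/-- The `s` in `D` with `s x ∈ J` form an ideal that extends to the unit ideal in every member of Θ,
so it contains `1`. -/
theorem mem_of_forall_mem_map {J : Ideal (integerValued D K)} {x : integerValued D K}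
    (h : ∀ (T : Subalgebra D K) (hT : T ∈ Θ), integerValuedInclusion T (hΘ.flat T hT) x ∈
      J.map (integerValuedInclusion T (hΘ.flat T hT))) : x ∈ J := by
  let I : Ideal D := Ideal.comap (integerValuedConst D D K)
    (Submodule.comap (LinearMap.toSpanSingleton (integerValued D K) (integerValued D K) x) J)
  have hI : I = ⊤ := by
    refine hΘ.eq_top_of_map_eq_top fun T hT => ?_
    obtain ⟨d, hd, hs⟩ := hΘ.exists_mul_mem_of_mem_map hT (h T hT)
    rw [← top_le_iff, ← hΘ.map_complementaryMultiples hT hd]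
    refine Ideal.map_mono fun s hs' => ?_
    obtain ⟨j, hj, hjx⟩ := hs s hs'
    change integerValuedConst D D K s * x ∈ J
    convert hj
    apply Subtype.ext
    rw [hjx, MulMemClass.coe_mul, coe_integerValuedConst]
    rfl
  have h1 : integerValuedConst D D K 1 * x ∈ J := (hI ▸ trivial : (1 : D) ∈ I)
  rwa [map_one, one_mul] at h1

/-- Ideals of `Int(D)` are determined by their extensions to the rings `Int(T)`. -/
theorem ideal_eq_of_map_eq {I J : Ideal (integerValued D K)}
    (h : ∀ (T : Subalgebra D K) (hT : T ∈ Θ),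
      I.map (integerValuedInclusion T (hΘ.flat T hT)) =
        J.map (integerValuedInclusion T (hΘ.flat T hT))) : I = J :=
  le_antisymm
    (fun _ hx => hΘ.mem_of_forall_mem_map fun T hT => h T hT ▸ Ideal.mem_map_of_mem _ hx)
    (fun _ hx => hΘ.mem_of_forall_mem_map fun T hT => (h T hT).symm ▸ Ideal.mem_map_of_mem _ hx)

theorem finite_picIntExtension_ne_one (c : ClassGroup (integerValued D K)) :
    {T : Θ | picIntExtension (T : Subalgebra D K) (hΘ.flat T T.2) c ≠ 1}.Finite := by
  obtain ⟨I, J, d, hd, hIJ, hI⟩ := c.exists_represents_unitary D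
  refine ((hΘ.locallyFinite d hd).preimage (Subtype.val_injective.injOn)).subset fun T hT => ?_
  refine ⟨T.2, fun hu => hT ?_⟩
  refine ((hI.picIntExtension (hΘ.flat T T.2)).eq_one_iff).mpr ⟨1, one_ne_zero, ?_⟩
  rw [map_inclusion_eq_top _ hIJ hu, Ideal.span_singleton_one]

end IsJaffardFamily

/-- If `I Int(D)` is generated by `g`, evaluation at `0` shows that `I` is generated by `g(0)`. -/
theorem extendedHom_integerValued_injective :
    Function.Injective (ClassGroup.extendedHom D (integerValued D K)) := by
  rw [injective_iff_map_eq_one]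
  intro c hc
  obtain ⟨I, J, a, -, -, hI⟩ := c.exists_represents
  obtain ⟨g, -, hg⟩ := (hI.map (B := integerValued D K)).eq_one_iff.mp hc
  have hIg : I = Ideal.span {integerValuedEvalZero D K g} := by
    have := congrArg (Ideal.map (integerValuedEvalZero D K)) hg
    rwa [Ideal.map_map, Ideal.map_span, Set.image_singleton,
      RingHom.ext (f := (integerValuedEvalZero D K).comp _) (g := RingHom.id D)
        integerValuedEvalZero_algebraMap, Ideal.map_id] at this
  refine hI.eq_one_iff.mpr ⟨_, fun h0 => hI.ne_bot ?_, hIg⟩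
  rw [hIg, h0, Ideal.span_singleton_eq_bot]

theorem picIntExtension_extendedHom_eq_one {T : Subalgebra D K} (hT : Module.Flat D T)
    {c : ClassGroup D} (hc : ClassGroup.extendedHom D T c = 1) :
    picIntExtension T hT (ClassGroup.extendedHom D (integerValued D K) c) = 1 := by
  obtain ⟨I, J, a, -, -, hI⟩ := c.exists_represents
  obtain ⟨x, hx0, hx⟩ := (hI.map (B := T)).eq_one_iff.mp hc
  have hI' := (hI.map (B := integerValued D K)).picIntExtension hT
  have hmap : (I.map (algebraMap D (integerValued D K))).map (integerValuedInclusion T hT) =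
      Ideal.span {algebraMap T (integerValued T K) x} := by
    rw [Ideal.map_map, ← Set.image_singleton, ← Ideal.map_span, ← hx, Ideal.map_map]
    congr 1
  refine hI'.eq_one_iff.mpr ⟨_, fun h0 => hI'.ne_bot ?_, hmap⟩
  rw [hmap, h0, Ideal.span_singleton_eq_bot]

theorem Ideal.Represents.exists_map_eq_span_const {I J : Ideal (integerValued D K)}
    {c : ClassGroup (integerValued D K)} (hI : I.Represents c) {d : D} (hd : d ≠ 0)
    (hIJ : I * J = Ideal.span {integerValuedConst D D K d}) {T : Subalgebra D K}
    (hT : Module.Flat D T) (hc : _root_.picIntExtension T hT c = 1) :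
    ∃ t : T, I.map (integerValuedInclusion T hT) =
      Ideal.span {algebraMap T (integerValued T K) t} := by
  obtain ⟨f, -, hf⟩ := (hI.picIntExtension hT).eq_one_iff.mp hc
  have hmem : integerValuedConst D D K d ∈ I :=
    Ideal.mul_le_left (hIJ.ge (Ideal.mem_span_singleton_self _))
  have hdvd : f ∣ integerValuedConst D T K d := by
    rw [← Ideal.mem_span_singleton, ← hf, ← integerValuedInclusion_comp_const T hT]
    exact Ideal.mem_map_of_mem _ hmem
  exact ⟨integerValuedEvalZero T K f, hf.trans (congrArg (fun g => Ideal.span {g})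
    (eq_algebraMap_of_dvd_const hd hdvd))⟩

theorem IsJaffardFamily.exists_relativePic_of_picIntExtension_eq_one {Θ : Set (Subalgebra D K)}
    (hΘ : IsJaffardFamily D K Θ) {c : ClassGroup (integerValued D K)}
    (hc : ∀ T : Θ, picIntExtension (T : Subalgebra D K) (hΘ.flat T T.2) c = 1) :
    ∃ b : relativePic Θ, relativePicToPicInt Θ b = c := by
  obtain ⟨J, J', d, hd, hJJ, hJ⟩ := c.exists_represents_unitary D
  have hprin : ∀ (T : Subalgebra D K) (hT : T ∈ Θ), ∃ t : T,
      J.map (integerValuedInclusion T (hΘ.flat T hT)) =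
        Ideal.span {algebraMap T (integerValued T K) t} := fun T hT =>
    hJ.exists_map_eq_span_const hd hJJ (hΘ.flat T hT) (hc ⟨T, hT⟩)
  -- The preimage is the class of `J` evaluated at `0`; evaluating `J J' = (d)` shows that this
  -- ideal of `D` is invertible.
  have hII : J.map (integerValuedEvalZero D K) * J'.map (integerValuedEvalZero D K) =
      Ideal.span {d} := by
    rw [← Ideal.map_mul, hJJ, Ideal.map_span, Set.image_singleton]
    congr 2
    exact integerValuedEvalZero_algebraMap d
  obtain ⟨b, hb⟩ := Ideal.exists_represents hd hII
  have hmap : ∀ (T : Subalgebra D K) (hT : T ∈ Θ) (t : T),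
      J.map (integerValuedInclusion T (hΘ.flat T hT)) =
        Ideal.span {algebraMap T (integerValued T K) t} →
      (J.map (integerValuedEvalZero D K)).map (algebraMap D T) = Ideal.span {t} := by
    intro T hT t ht
    rw [Ideal.map_map, ← integerValuedEvalZero_comp_inclusion T (hΘ.flat T hT), ← Ideal.map_map,
      ht, Ideal.map_span, Set.image_singleton, integerValuedEvalZero_algebraMap]
  have hbT : b ∈ relativePic Θ := by
    simp only [relativePic, Subgroup.mem_iInf, MonoidHom.mem_ker]
    intro T hT
    obtain ⟨t, ht⟩ := hprin T hT
    refine (hb.map (B := T)).eq_one_iff.mpr ⟨t, fun h0 => (hb.map (B := T)).ne_bot ?_,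
      hmap T hT t ht⟩
    rw [hmap T hT t ht, h0, Ideal.span_singleton_eq_bot]
  refine ⟨⟨b, hbT⟩, (hb.map (B := integerValued D K)).unique ?_⟩
  convert hJ
  -- Both ideals extend to the ideal of `Int(T)` generated by the same constant `t`.
  refine hΘ.ideal_eq_of_map_eq fun T hT => ?_
  obtain ⟨t, ht⟩ := hprin T hT
  have hcomp : (integerValuedInclusion T (hΘ.flat T hT)).comp
      (algebraMap D (integerValued D K)) =
      (algebraMap T (integerValued T K)).comp (algebraMap D T) :=
    integerValuedInclusion_comp_const T (hΘ.flat T hT)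
  rw [Ideal.map_map (algebraMap D (integerValued D K)), hcomp, ← Ideal.map_map, hmap T hT t ht,
    ht, Ideal.map_span, Set.image_singleton]

end Extension
-- Lifting classes from a single member of Θ
section Surjectivity

variable {D K : Type*} [CommRing D] [IsDomain D] [Field K] [Algebra D K] [IsFractionRing D K]

namespace IsJaffardFamily

variable {Θ : Set (Subalgebra D K)} (hΘ : IsJaffardFamily D K Θ)
include hΘ

theorem map_inclusion_comap {T : Subalgebra D K} (hT : T ∈ Θ) (J : Ideal (integerValued T K)) :
    (J.comap (integerValuedInclusion T (hΘ.flat T hT))).map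
      (integerValuedInclusion T (hΘ.flat T hT)) = J := by
  refine le_antisymm Ideal.map_comap_le fun y hy => ?_
  obtain ⟨d, hd, hden⟩ := exists_common_denominator (D := D) {(y : K[X])}
  obtain ⟨p, hp⟩ := hden y (Finset.mem_singleton_self _)
  refine hΘ.mem_of_forall_complementaryMultiples hT hd fun s hs => ?_
  have heq : integerValuedConst D T K s * y = integerValuedInclusion T (hΘ.flat T hT)
      ⟨_, hΘ.const_mul_mem_integerValued y.2 hp hs⟩ := by
    apply Subtype.ext
    rw [MulMemClass.coe_mul, coe_integerValuedConst]
    rfl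
  rw [heq]
  refine Ideal.mem_map_of_mem _ (Ideal.mem_comap.mpr ?_)
  rw [← heq]
  exact Ideal.mul_mem_left _ _ hy

/-- The `s` divisible by `a` in all members other than `T'` are divisible by `a` in `T`, so they lie
in `J`; they generate the unit ideal of `T'`. -/
theorem map_inclusion_comap_eq_top {T T' : Subalgebra D K} (hT : T ∈ Θ) (hT' : T' ∈ Θ)
    (hne : T' ≠ T) {J : Ideal (integerValued T K)} {a : D} (ha : a ≠ 0)
    (haJ : integerValuedConst D T K a ∈ J) :
    (J.comap (integerValuedInclusion T (hΘ.flat T hT))).map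
      (integerValuedInclusion T' (hΘ.flat T' hT')) = ⊤ := by
  rw [Ideal.eq_top_iff_one]
  refine hΘ.mem_of_forall_complementaryMultiples hT' ha fun s hs => ?_
  rw [mul_one, ← integerValuedInclusion_comp_const T' (hΘ.flat T' hT')]
  refine Ideal.mem_map_of_mem _ (Ideal.mem_comap.mpr ?_)
  rw [← RingHom.comp_apply, integerValuedInclusion_comp_const]
  obtain ⟨t, ht⟩ := exists_of_mem_complementaryMultiples hs hT hne.symm
  rw [integerValuedConst, RingHom.comp_apply, ht, map_mul]
  exact Ideal.mul_mem_right _ _ haJ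

/-- The elements of `J ∩ Int(D)` that are multiples of `a` in `Int(T')`, for all members `T'` of
`Θ` other than `T`. -/
def multiplesIdeal {T : Subalgebra D K} (hT : T ∈ Θ) (J : Ideal (integerValued T K)) (a : D) :
    Ideal (integerValued D K) :=
  J.comap (integerValuedInclusion T (hΘ.flat T hT)) ⊓
    ⨅ T' : {T' // T' ∈ Θ ∧ T' ≠ T}, (Ideal.span {integerValuedConst D T'.1 K a}).comap
      (integerValuedInclusion T'.1 (hΘ.flat T' T'.2.1))

theorem mem_multiplesIdeal {T : Subalgebra D K} {hT : T ∈ Θ} {J : Ideal (integerValued T K)}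
    {a : D} {f : integerValued D K} : f ∈ hΘ.multiplesIdeal hT J a ↔
      integerValuedInclusion T (hΘ.flat T hT) f ∈ J ∧ ∀ T' (hT' : T' ∈ Θ), T' ≠ T →
        integerValuedConst D T' K a ∣ integerValuedInclusion T' (hΘ.flat T' hT') f := by
  simp only [multiplesIdeal, Submodule.mem_inf, Submodule.mem_iInf, Ideal.mem_comap,
    Ideal.mem_span_singleton, Subtype.forall]
  exact and_congr_right fun _ => ⟨fun h T' hT' hne => h T' ⟨hT', hne⟩,
    fun h T' hT' => h T' hT'.1 hT'.2⟩

theorem map_multiplesIdeal {T : Subalgebra D K} (hT : T ∈ Θ) (J : Ideal (integerValued T K))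
    {a : D} (ha : a ≠ 0) :
    (hΘ.multiplesIdeal hT J a).map (integerValuedInclusion T (hΘ.flat T hT)) = J := by
  refine le_antisymm (Ideal.map_le_iff_le_comap.mpr inf_le_left) fun y hy => ?_
  obtain ⟨d, hd, hden⟩ := exists_common_denominator (D := D) {(y : K[X])}
  obtain ⟨p, hp⟩ := hden y (Finset.mem_singleton_self _)
  -- In `d * a`, the factor `d` clears the denominators of `y` and `a` supplies the divisibility
  -- that `multiplesIdeal` demands.
  refine hΘ.mem_of_forall_complementaryMultiples hT (mul_ne_zero hd ha) fun s hs => ?_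
  have hsy := hΘ.const_mul_mem_integerValued y.2 hp
    (complementaryMultiples_anti (dvd_mul_right d a) hs)
  have heq : integerValuedConst D T K s * y = integerValuedInclusion T (hΘ.flat T hT)
      ⟨_, hsy⟩ := by
    apply Subtype.ext
    rw [MulMemClass.coe_mul, coe_integerValuedConst]
    rfl
  rw [heq]
  refine Ideal.mem_map_of_mem _ (hΘ.mem_multiplesIdeal.mpr ⟨?_, fun T' hT' hne => ?_⟩)
  · rw [← heq]
    exact Ideal.mul_mem_left _ _ hy
  · obtain ⟨t, ht⟩ := exists_of_mem_complementaryMultiples hs hT' hne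
    have ht' : algebraMap D K s = algebraMap D K (d * a) * (t : K) := congrArg Subtype.val ht
    refine ⟨algebraMap T' (integerValued T' K) t *
      ⟨_, Polynomial.map_mem_integerValued_of_tower p⟩, Subtype.ext ?_⟩
    rw [MulMemClass.coe_mul, coe_integerValuedConst]
    change C (algebraMap D K s) * (y : K[X]) =
      C (algebraMap D K a) * (C (t : K) * p.map (algebraMap D K))
    rw [ht', hp, C_mul, map_mul, C_mul]
    ring

theorem map_multiplesIdeal_eq_span {T T' : Subalgebra D K} (hT : T ∈ Θ) (hT' : T' ∈ Θ)
    (hne : T' ≠ T) {J : Ideal (integerValued T K)} {a : D}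
    (haJ : integerValuedConst D T K a ∈ J) :
    (hΘ.multiplesIdeal hT J a).map (integerValuedInclusion T' (hΘ.flat T' hT')) =
      Ideal.span {integerValuedConst D T' K a} := by
  refine le_antisymm (Ideal.map_le_iff_le_comap.mpr fun f hf =>
    Ideal.mem_span_singleton.mpr ((hΘ.mem_multiplesIdeal.mp hf).2 T' hT' hne)) ?_
  rw [Ideal.span_singleton_le_iff_mem, ← integerValuedInclusion_comp_const T' (hΘ.flat T' hT')]
  refine Ideal.mem_map_of_mem _ (hΘ.mem_multiplesIdeal.mpr ⟨?_, fun S hS _ => ?_⟩)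
  · rwa [← RingHom.comp_apply, integerValuedInclusion_comp_const]
  · rw [← RingHom.comp_apply, integerValuedInclusion_comp_const]

/-- With `J J' = (a)`, the contraction of `J` times `multiplesIdeal` of `J'` extends to `J J'` at
`T` and to `(1)(a)` elsewhere. It is therefore `(a)` already in `Int(D)`, which makes the
contraction invertible. -/
theorem exists_picIntExtension_eq {T : Subalgebra D K} (hT : T ∈ Θ)
    (c : ClassGroup (integerValued T K)) :
    ∃ b : ClassGroup (integerValued D K), picIntExtension T (hΘ.flat T hT) b = c ∧
      ∀ T' (hT' : T' ∈ Θ), T' ≠ T → picIntExtension T' (hΘ.flat T' hT') b = 1 := by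
  obtain ⟨J, J', a, ha, hJJ, hJ⟩ := c.exists_represents_unitary D
  have hspan := hJJ.ge (Ideal.mem_span_singleton_self _)
  have haJ : integerValuedConst D T K a ∈ J := Ideal.mul_le_left hspan
  have haJ' : integerValuedConst D T K a ∈ J' := Ideal.mul_le_right hspan
  have hprod : J.comap (integerValuedInclusion T (hΘ.flat T hT)) * hΘ.multiplesIdeal hT J' a =
      Ideal.span {integerValuedConst D D K a} := by
    refine hΘ.ideal_eq_of_map_eq fun T' hT' => ?_
    rw [Ideal.map_mul, Ideal.map_span, Set.image_singleton, ← RingHom.comp_apply,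
      integerValuedInclusion_comp_const]
    by_cases hne : T' = T
    · subst hne
      rw [hΘ.map_inclusion_comap hT, hΘ.map_multiplesIdeal hT J' ha, hJJ]
    · rw [hΘ.map_inclusion_comap_eq_top hT hT' hne ha haJ, Ideal.top_mul,
        hΘ.map_multiplesIdeal_eq_span hT hT' hne haJ']
  obtain ⟨b, hb⟩ := Ideal.exists_represents (integerValuedConst_ne_zero ha) hprod
  refine ⟨b, ?_, fun T' hT' hne => ?_⟩
  · have h := hb.picIntExtension (hΘ.flat T hT)
    rw [hΘ.map_inclusion_comap hT] at h
    exact h.unique hJ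
  · refine (hb.picIntExtension (hΘ.flat T' hT')).eq_one_iff.mpr ⟨1, one_ne_zero, ?_⟩
    rw [hΘ.map_inclusion_comap_eq_top hT hT' hne ha haJ, Ideal.span_singleton_one]

/-- The extension maps `Pic(Int(D)) → Pic(Int(T))` together, with values in the direct sum. -/
theorem exists_directSum_extension :
    ∃ π : Additive (ClassGroup (integerValued D K)) →+
        ⨁ T : Θ, Additive (ClassGroup (integerValued (T : Subalgebra D K) K)),
      ∀ (c : ClassGroup (integerValued D K)) (T : Θ), π (Additive.ofMul c) T =
        Additive.ofMul (picIntExtension (T : Subalgebra D K) (hΘ.flat T T.2) c) := by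
  classical
  have h : ∀ c : ClassGroup (integerValued D K),
      ∃ x : ⨁ T : Θ, Additive (ClassGroup (integerValued (T : Subalgebra D K) K)), ∀ T : Θ,
        x T = Additive.ofMul (picIntExtension (T : Subalgebra D K) (hΘ.flat T T.2) c) := by
    intro c
    refine ⟨DFinsupp.mk (hΘ.finite_picIntExtension_ne_one c).toFinset fun T =>
      Additive.ofMul (picIntExtension (T : Θ).1 (hΘ.flat _ (T : Θ).2) c), fun T => ?_⟩
    refine (DFinsupp.mk_apply).trans ?_
    split_ifs with hT
    · rfl
    · rw [Set.Finite.mem_toFinset, Set.mem_ofPred_eq, not_not] at hT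
      rw [hT]
      rfl
  choose x hx using h
  refine ⟨AddMonoidHom.mk' (fun c => x c.toMul) fun c c' => DFinsupp.ext fun T => ?_,
    fun c T => hx c T⟩
  rw [DirectSum.add_apply, hx, hx, hx, toMul_add, map_mul, ofMul_mul]

end IsJaffardFamily

end Surjectivity
end

theorem mainTheorem2 {D K : Type*} [CommRing D] [IsDomain D] [Field K] [Algebra D K]
    [IsFractionRing D K] (Θ : Set (Subalgebra D K)) (hΘ : IsJaffardFamily D K Θ) :
    ∃ π : Additive (ClassGroup (integerValued D K)) →+
        ⨁ T : Θ, Additive (ClassGroup (integerValued (T : Subalgebra D K) K)),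
      (∀ (c : ClassGroup (integerValued D K)) (T : Θ),
        π (Additive.ofMul c) T =
          Additive.ofMul (picIntExtension (T : Subalgebra D K) (hΘ.flat T T.2) c)) ∧
      Function.Injective (relativePicToPicInt Θ).toAdditive ∧
      Function.Exact (relativePicToPicInt Θ).toAdditive π ∧
      Function.Surjective π := by
  classical
  obtain ⟨π, hπ⟩ := hΘ.exists_directSum_extension
  refine ⟨π, hπ, ?_, fun c => ⟨fun hc => ?_, ?_⟩, ?_⟩
  · exact extendedHom_integerValued_injective.comp Subtype.val_injective
  · obtain ⟨b, hb⟩ := hΘ.exists_relativePic_of_picIntExtension_eq_one (c := c.toMul) fun T => by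
      have h := hπ c.toMul T
      rw [ofMul_toMul, hc] at h
      exact h.symm
    exact ⟨Additive.ofMul b, hb⟩
  · rintro ⟨b, rfl⟩
    refine DFinsupp.ext fun T => (hπ _ T).trans ?_
    refine picIntExtension_extendedHom_eq_one (hΘ.flat T T.2) ?_
    have hb := b.toMul.2
    simp only [relativePic, Subgroup.mem_iInf, MonoidHom.mem_ker] at hb
    exact hb T T.2
  · intro x
    induction x using DirectSum.induction_on with
    | zero => exact ⟨0, map_zero π⟩
    | of T c =>
      obtain ⟨b, hb, hb1⟩ := hΘ.exists_picIntExtension_eq T.2 c.toMul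
      refine ⟨Additive.ofMul b, DFinsupp.ext fun T' => (hπ b T').trans ?_⟩
      by_cases hne : T' = T
      · subst hne
        rw [hb, DirectSum.of_eq_same]
        rfl
      · rw [hb1 T' T'.2 (fun h => hne (Subtype.ext h)), DirectSum.of_eq_of_ne _ _ _ hne]
        rfl
    | add x y hx hy =>
      obtain ⟨c, rfl⟩ := hx
      obtain ⟨c', rfl⟩ := hy
      exact ⟨c + c', map_add π c c'⟩
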